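/- Let $\mathbb K$ be a field and let $m,n_1,n_2$ be integers with $m\ge 2$, $1\le n_1\le n_2$ and $n_2\ge 2$. Let $G=K_{n_1,n_2}$ be the complete bipartite graph with parts of sizes $n_1$ and $n_2$, put $n=n_1+n_2$ and $V(G)=[n]$, and let $S=\mathbb K[x_{ij}: i\in[m],\ j\in[n]]$ with its standard grading. Let $$\mathcal J_{K_m,G}=\bigl(x_{ik}x_{jl}-x_{il}x_{jk} \;:\; 1\le i<j\le m,\ 1\le k<l\le n,\ \{k,l\}\in E(G)\bigr)\subseteq S$$ be the generalized binomial edge ideal of $G$. For a graded quotient $S/I$ with Hilbert polynomial $P\neq 0$ of degree $D$, the multiplicity $\operatorname{e}(S/I)$ is $D!$ times the leading coefficient of $P$ (and it is $\dim_{\mathbb K}S/I$ if $P=0$). Then $$\operatorname{e}(S/\mathcal J_{K_m,G})=\begin{cases} 1, & \text{if } \max\{m+n_1+n_2-1,\,mn_1\}<mn_2,\\ 2, & \text{if } m+n_1+n_2-1<mn_1=mn_2,\\ 2n_2, & \text{if } mn_2<m+n_1+n_2-1,\\ 12, & \text{if } m+n_1+n_2-1=mn_1=mn_2,\\ \displaystyle\sum_{k\ge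 0}\binom{m-1}{k}\binom{n_1+n_2-1}{k}+1, & \text{if } mn_1<m+n_1+n_2-1=mn_2, \end{cases}$$ and these five cases cover all possibilities. -/

import Mathlib

namespace GenBinomEdge

open MvPolynomial

/-- The binomial edge ideal of the pair of graphs `(G₁, G₂)` in the polynomial ring
`K[x_{ik} : i ∈ V, k ∈ W]`: it is generated by the 2-minors `x_{ik} x_{jl} - x_{il} x_{jk}`
with `{i, j}` an edge of `G₁` and `{k, l}` an edge of `G₂`.  (Exchanging `i` and `j`, or `k` and
`l`, only changes the sign of the minor, so no ordering of the vertices is needed.) -/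
noncomputable def pairIdeal (K : Type*) [Field K] {V W : Type*}
    (G₁ : SimpleGraph V) (G₂ : SimpleGraph W) : Ideal (MvPolynomial (V × W) K) :=
  Ideal.span {p | ∃ i j k l, G₁.Adj i j ∧ G₂.Adj k l ∧
    p = X (i, k) * X (j, l) - X (i, l) * X (j, k)}

/-- The generalized binomial edge ideal `J_{K_m, G}`: the binomial edge ideal of the pair
`(K_m, G)`, where `K_m` is the complete graph on `m` vertices. -/
noncomputable def genIdeal (K : Type*) [Field K] (m : ℕ) {W : Type*} (G : SimpleGraph W) :
    Ideal (MvPolynomial (Fin m × W) K) :=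
  pairIdeal K (⊤ : SimpleGraph (Fin m)) G

section Multiplicity

variable {K : Type*} [Field K] {σ : Type*}

/-- The degree `d` part of `S ⧸ I`, where `S = K[x_i : i ∈ σ]` has the standard grading
(and `I` is a homogeneous ideal): the image of the space of forms of degree `d`. -/
noncomputable def gradedPart (I : Ideal (MvPolynomial σ K)) (d : ℕ) :
    Submodule K (MvPolynomial σ K ⧸ I) :=
  (homogeneousSubmodule σ K d).map (Ideal.Quotient.mkₐ K I).toLinearMap

/-- The Hilbert function `d ↦ dim_K (S ⧸ I)_d`. -/
noncomputable def hilbertFunction (I : Ideal (MvPolynomial σ K)) (d : ℕ) : ℕ :=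
  Module.finrank K (gradedPart I d)

/-- `P` is the Hilbert polynomial of `S ⧸ I`: it agrees with the Hilbert function in all
large degrees. -/
def IsHilbertPolynomial (I : Ideal (MvPolynomial σ K)) (P : Polynomial ℚ) : Prop :=
  ∀ᶠ d : ℕ in Filter.atTop, P.eval (d : ℚ) = (hilbertFunction I d : ℚ)

/-- The Hilbert polynomial is unique. -/
theorem IsHilbertPolynomial.unique {I : Ideal (MvPolynomial σ K)} {P Q : Polynomial ℚ}
    (hP : IsHilbertPolynomial I P) (hQ : IsHilbertPolynomial I Q) : P = Q := by
  obtain ⟨N, hN⟩ := Filter.eventually_atTop.1 (hP.and hQ)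
  refine Polynomial.eq_of_infinite_eval_eq P Q
    (Set.Infinite.mono (s := (fun d : ℕ => (d : ℚ)) '' Set.Ici N) ?_ ?_)
  · rintro _ ⟨d, hd, rfl⟩
    exact (hN d hd).1.trans (hN d hd).2.symm
  · exact (Set.Ici_infinite N).image (Nat.cast_injective.injOn)

open Classical in
/-- The multiplicity `e(S ⧸ I)` of the standard graded algebra `S ⧸ I`.  If the Hilbert polynomial
`P` is nonzero, of degree `D` (so that `S ⧸ I` has dimension `D + 1`), then it is `D !` times the
leading coefficient of `P`.  If `P = 0` (so that `S ⧸ I` has finite length), then it is the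
length, that is, the `K`-dimension, of `S ⧸ I`.
(For homogeneous `I` and finite `σ` the Hilbert polynomial always exists; the value `0` otherwise
is a convention.) -/
noncomputable def mult (I : Ideal (MvPolynomial σ K)) : ℚ :=
  if h : ∃ P : Polynomial ℚ, IsHilbertPolynomial I P then
    if h.choose = 0 then (Module.finrank K (MvPolynomial σ K ⧸ I) : ℚ)
    else (h.choose.natDegree.factorial : ℚ) * h.choose.leadingCoeff
  else 0

end Multiplicity

end GenBinomEdge

/-! The ideal is spanned by differences of monomials, so the Hilbert function counts classes of
monomials (`hilbertFunction_eq_ncard`). A monomial whose columns lie in one part is alone in its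
class. Any other is determined by its row and column degrees, because a variable from the opposite
part lets every 2-minor move be performed (`mon_swap`) and such moves connect all tables with given
margins (`margin_induction`).

Counting gives, for `d > 0`, with `((k,d))` the number of degree `d` monomials in `k` variables,
`((ma,d)) + ((mb,d)) + ((m,d)) * (((a+b,d)) - ((a,d)) - ((b,d)))`. The first three terms have
degrees `ma-1`, `mb-1`, `m+a+b-2` and normalized leading coefficients `1`, `1`, `C(m+a+b-2, m-1)`;
the subtracted products have smaller degree than the third. The multiplicity adds the contributions
of top degree, and the cases are arithmetic. -/

namespace GenBinomEdge

open MvPolynomial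

/-! ### Hilbert functions as counts of monomial classes. -/

section HilbertFunctionCount

variable {K : Type*} [Field K] {σ : Type*}

/-- The linear map `K[x_i : i ∈ σ] → K^(Q)` that sends the monomial `x^u` to the basis vector
`q u`. -/
noncomputable def classMap (K : Type*) [Field K] {σ Q : Type*} (q : (σ →₀ ℕ) → Q) :
    MvPolynomial σ K →ₗ[K] (Q →₀ K) :=
  (basisMonomials σ K).constr K fun u => Finsupp.single (q u) 1

theorem classMap_monomial {Q : Type*} (q : (σ →₀ ℕ) → Q) (u : σ →₀ ℕ) :
    classMap K q (monomial u 1) = Finsupp.single (q u) 1 := by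
  have h := (basisMonomials σ K).constr_basis K (fun u => Finsupp.single (q u) (1 : K)) u
  rwa [coe_basisMonomials] at h

/-- `classMap` vanishes on an ideal generated by differences of monomials that `q` does not
separate. -/
theorem classMap_eq_zero {Q : Type*} (q : (σ →₀ ℕ) → Q) {s : Set (MvPolynomial σ K)}
    (hs : ∀ g ∈ s, ∃ u v, g = monomial u 1 - monomial v 1 ∧ ∀ w, q (w + u) = q (w + v))
    {f : MvPolynomial σ K} (hf : f ∈ Ideal.span s) : classMap K q f = 0 := by
  suffices h : ∀ a, classMap K q (a * f) = 0 by simpa using h 1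
  induction hf using Submodule.span_induction with
  | mem g hg =>
    obtain ⟨u, v, rfl, h⟩ := hs g hg
    intro a
    induction a using MvPolynomial.induction_on' with
    | monomial w c =>
      have e : (monomial w c : MvPolynomial σ K) * (monomial u 1 - monomial v 1) =
          c • (monomial (w + u) 1 - monomial (w + v) 1) := by
        simp [mul_sub, smul_sub, monomial_mul, smul_monomial]
      rw [e, map_smul, map_sub, classMap_monomial, classMap_monomial, h, sub_self, smul_zero]
    | add p r hp hr => rw [add_mul, map_add, hp, hr, add_zero]
  | zero => simp
  | add x y _ _ hx hy => intro a; rw [mul_add, map_add, hx, hy, add_zero]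
  | smul b x _ hx => intro a; rw [smul_eq_mul, ← mul_assoc]; exact hx _

theorem gradedPart_eq_span (I : Ideal (MvPolynomial σ K)) (d : ℕ) :
    gradedPart I d = Submodule.span K
      ((fun u : σ →₀ ℕ => Ideal.Quotient.mk I (monomial u 1)) '' {u | u.degree = d}) := by
  rw [gradedPart, homogeneousSubmodule_eq_finsupp_supported,
    AddMonoidAlgebra.supported_eq_span_single, Submodule.map_span, Set.image_image]
  rfl

/-- If `q` classifies the monomials modulo `I`, then the Hilbert function of `I` counts the
classes. -/
theorem hilbertFunction_eq_ncard {Q : Type*} (q : (σ →₀ ℕ) → Q) (I : Ideal (MvPolynomial σ K))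
    (hker : ∀ f ∈ I, classMap K q f = 0)
    (hq : ∀ u v, q u = q v →
      Ideal.Quotient.mk I (monomial u 1) = Ideal.Quotient.mk I (monomial v 1)) (d : ℕ) :
    hilbertFunction I d = (q '' {u | u.degree = d}).ncard := by
  classical
  set T : Set Q := q '' {u | u.degree = d} with hT
  choose s hs hqs using fun a : T => a.2
  let b : T → MvPolynomial σ K ⧸ I := fun a => Ideal.Quotient.mk I (monomial (s a) 1)
  -- The descended map sends the chosen representatives to distinct basis vectors, which forces
  -- their independence.
  let Ψ : (MvPolynomial σ K ⧸ I) →ₗ[K] (Q →₀ K) :=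
    (I.restrictScalars K).liftQ (classMap K q) fun f hf => hker f hf
  have hΨ : ∀ a, Ψ (b a) = Finsupp.single (a : Q) 1 := fun a => by
    have : Ψ (b a) = classMap K q (monomial (s a) 1) := rfl
    rw [this, classMap_monomial, hqs]
  have hli : LinearIndependent K b := by
    refine LinearIndependent.of_comp Ψ ?_
    have : (Ψ ∘ b) = (fun i : Q => Finsupp.single i (1 : K)) ∘ ((↑) : T → Q) := funext hΨ
    rw [this]
    exact (Finsupp.linearIndependent_single_one K Q).comp _ Subtype.val_injective
  have hspan : Submodule.span K (Set.range b) = gradedPart I d := by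
    rw [gradedPart_eq_span]
    congr 1
    ext y
    constructor
    · rintro ⟨a, rfl⟩
      exact ⟨s a, hs a, rfl⟩
    · rintro ⟨u, hu, rfl⟩
      exact ⟨⟨q u, u, hu, rfl⟩, hq _ _ (hqs _)⟩
  rw [hilbertFunction, ← hspan, Module.finrank_eq_nat_card_basis (Module.Basis.span hli)]
  rfl

end HilbertFunctionCount

/-! ### Tables with prescribed margins. -/

section Margins

variable {V W : Type*}

theorem exists_eq_single_add {α : Type*} (f : α →₀ ℕ) {i : α} (hi : f i ≠ 0) :
    ∃ g, f = Finsupp.single i 1 + g :=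
  ⟨f - Finsupp.single i 1, (add_tsub_cancel_of_le
    (Finsupp.single_le_iff.2 (Nat.one_le_iff_ne_zero.2 hi))).symm⟩

/-- Put one unit in the cell of a nonzero row and a nonzero column, then recurse on the total. -/
theorem exists_margins (r : V →₀ ℕ) (c : W →₀ ℕ) (h : r.degree = c.degree) :
    ∃ u : V × W →₀ ℕ, u.mapDomain Prod.fst = r ∧ u.mapDomain Prod.snd = c := by
  induction hd : r.degree generalizing r c with
  | zero =>
    rw [hd, eq_comm] at h
    rw [Finsupp.degree_eq_zero_iff] at h hd
    exact ⟨0, by simp [h, hd]⟩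
  | succ d ih =>
    have hr : r ≠ 0 := by rintro rfl; simp at hd
    have hc : c ≠ 0 := by rintro rfl; simp [hd] at h
    obtain ⟨i, hi⟩ := Finsupp.ne_iff.1 hr
    obtain ⟨k, hk⟩ := Finsupp.ne_iff.1 hc
    obtain ⟨r, rfl⟩ := exists_eq_single_add r hi
    obtain ⟨c, rfl⟩ := exists_eq_single_add c hk
    simp only [map_add, Finsupp.degree_single] at h hd
    obtain ⟨u, rfl, rfl⟩ := ih r c (by omega) (by omega)
    exact ⟨Finsupp.single (i, k) 1 + u, by simp [Finsupp.mapDomain_add]⟩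

theorem mapDomain_fst_apply [Fintype W] (u : V × W →₀ ℕ) (i : V) :
    u.mapDomain Prod.fst i = ∑ k, u (i, k) := by
  classical
  induction u using Finsupp.induction_linear with
  | zero => simp
  | add u v hu hv => simp [Finsupp.mapDomain_add, hu, hv, Finset.sum_add_distrib]
  | single a n =>
    obtain ⟨j, l⟩ := a
    by_cases h : j = i <;> simp [Finsupp.single_apply, h]

theorem mapDomain_snd_apply [Fintype V] (u : V × W →₀ ℕ) (k : W) :
    u.mapDomain Prod.snd k = ∑ i, u (i, k) := by
  classical
  induction u using Finsupp.induction_linear with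
  | zero => simp
  | add u v hu hv => simp [Finsupp.mapDomain_add, hu, hv, Finset.sum_add_distrib]
  | single a n =>
    obtain ⟨j, l⟩ := a
    by_cases h : l = k <;> simp [Finsupp.single_apply, h]

theorem mapDomain_snd_support_subset [Fintype V] (u : V × W →₀ ℕ) (s : Finset W) :
    (u.mapDomain Prod.snd).support ⊆ s ↔ u.support ⊆ Finset.univ ×ˢ s := by
  simp only [Finset.subset_iff, Finsupp.mem_support_iff, mapDomain_snd_apply, Finset.mem_product,
    Finset.mem_univ, true_and, Prod.forall, ne_eq, Finset.sum_eq_zero_iff, true_imp_iff, not_forall]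
  exact ⟨fun h i k hk => h ⟨i, hk⟩, fun h k ⟨i, hk⟩ => h i k hk⟩

/-- Two tables of natural numbers with the same margins are connected by moves on `2 × 2` minors,
each of which stays among the tables with these margins. -/
theorem margin_induction [Fintype V] [Fintype W] {E : (V × W →₀ ℕ) → (V × W →₀ ℕ) → Prop}
    (refl : ∀ u, E u u) (trans : ∀ u v w, E u v → E v w → E u w)
    {r : V →₀ ℕ} {c : W →₀ ℕ}
    (swap : ∀ i j k l w,
      (Finsupp.single (i, k) 1 + (Finsupp.single (j, l) 1 + w)).mapDomain Prod.fst = r →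
      (Finsupp.single (i, k) 1 + (Finsupp.single (j, l) 1 + w)).mapDomain Prod.snd = c →
      E (Finsupp.single (i, k) 1 + (Finsupp.single (j, l) 1 + w))
        (Finsupp.single (i, l) 1 + (Finsupp.single (j, k) 1 + w)))
    {u v : V × W →₀ ℕ} (hur : u.mapDomain Prod.fst = r) (huc : u.mapDomain Prod.snd = c)
    (hvr : v.mapDomain Prod.fst = r) (hvc : v.mapDomain Prod.snd = c) : E u v := by
  classical
  -- The truncated difference measures only the deficit of `u` below `v`.
  induction hN : ∑ p, (v p - u p) using Nat.strong_induction_on generalizing u with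
  | _ N ih =>
    by_cases huv : v = u
    · rw [huv]; exact refl u
    have hrow : ∀ i, ∑ k, u (i, k) = ∑ k, v (i, k) := fun i => by
      rw [← mapDomain_fst_apply, ← mapDomain_fst_apply, hur, hvr]
    have hcol : ∀ k, ∑ i, u (i, k) = ∑ i, v (i, k) := fun k => by
      rw [← mapDomain_snd_apply, ← mapDomain_snd_apply, huc, hvc]
    obtain ⟨i, k, hik⟩ : ∃ i k, u (i, k) < v (i, k) := by
      by_contra! h
      refine huv (Finsupp.ext fun ⟨i, k⟩ => ?_)
      exact (Finset.sum_eq_sum_iff_of_le fun k _ => h i k).1 (hrow i).symm k (Finset.mem_univ k)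
    obtain ⟨l, hil⟩ : ∃ l, v (i, l) < u (i, l) := by
      by_contra! h
      exact (Finset.sum_lt_sum (fun l _ => h l) ⟨k, Finset.mem_univ k, hik⟩).ne (hrow i)
    obtain ⟨j, hjk⟩ : ∃ j, v (j, k) < u (j, k) := by
      by_contra! h
      exact (Finset.sum_lt_sum (fun l _ => h l) ⟨i, Finset.mem_univ i, hik⟩).ne (hcol k)
    have hkl : k ≠ l := by rintro rfl; omega
    have hij : i ≠ j := by rintro rfl; omega
    obtain ⟨w, rfl⟩ := exists_eq_single_add u (i := (i, l)) (by omega)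
    obtain ⟨w, rfl⟩ := exists_eq_single_add w (i := (j, k)) (by
      simp [hij] at hjk; omega)
    -- The move fills the deficit at `(i, k)` and lowers only the surplus cells `(i, l)` and `(j,
    -- k)`, so the total deficit drops.
    refine trans _ _ _ (swap i j l k w hur huc) (ih _ ?_ ?_ ?_ rfl)
    · rw [← hN]
      refine Finset.sum_lt_sum (fun p _ => ?_) ⟨(i, k), Finset.mem_univ _, ?_⟩
      · by_cases h1 : p = (i, l)
        · subst h1; simp [hkl.symm, hij] at hil ⊢; omega
        by_cases h2 : p = (j, k)
        · subst h2; simp [hkl, hij.symm] at hjk ⊢; omega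
        simp only [Finsupp.add_apply, Finsupp.single_eq_of_ne h1, Finsupp.single_eq_of_ne h2]
        omega
      · simp [hkl, hij] at hik ⊢; omega
    · rw [← hur]; simp [Finsupp.mapDomain_add]
    · rw [← huc]; simp only [Finsupp.mapDomain_add, Finsupp.mapDomain_single]; abel

end Margins

end GenBinomEdge
namespace GenBinomEdge

open MvPolynomial

/-! ### Monomial classes for complete bipartite graphs. -/

section CompleteBipartite

variable {K : Type*} [Field K] {m : ℕ} {A B : Type*}

/-- The residue class of the monomial `x^u`. -/
noncomputable def mon {σ : Type*} (I : Ideal (MvPolynomial σ K)) (u : σ →₀ ℕ) :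
    MvPolynomial σ K ⧸ I :=
  Ideal.Quotient.mk I (monomial u 1)

theorem mon_add {σ : Type*} (I : Ideal (MvPolynomial σ K)) (u v : σ →₀ ℕ) :
    mon I (u + v) = mon I u * mon I v := by
  rw [mon, mon, mon, ← map_mul, monomial_mul, one_mul]

theorem mon_adj {W : Type*} (G : SimpleGraph W) {k l : W} (h : G.Adj k l) (i j : Fin m) :
    mon (genIdeal K m G) (Finsupp.single (i, k) 1) * mon (genIdeal K m G) (Finsupp.single (j, l) 1) =
    mon (genIdeal K m G) (Finsupp.single (i, l) 1) *
      mon (genIdeal K m G) (Finsupp.single (j, k) 1) := by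
  by_cases hij : i = j
  · subst hij; exact mul_comm _ _
  · rw [mon, mon, mon, mon, ← map_mul, ← map_mul, Ideal.Quotient.eq]
    exact Ideal.subset_span ⟨i, j, k, l, hij, h, rfl⟩

/-- Modulo the ideal of a complete bipartite graph, a monomial that involves columns from both
parts may be changed by a move on any `2 × 2` minor. -/
theorem mon_swap (i j : Fin m) (k l : A ⊕ B) (w : Fin m × (A ⊕ B) →₀ ℕ)
    (hA : ∃ h a, (Finsupp.single (i, k) 1 + (Finsupp.single (j, l) 1 + w) : Fin m × (A ⊕ B) →₀ ℕ)
      (h, Sum.inl a) ≠ 0)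
    (hB : ∃ h b, (Finsupp.single (i, k) 1 + (Finsupp.single (j, l) 1 + w) : Fin m × (A ⊕ B) →₀ ℕ)
      (h, Sum.inr b) ≠ 0) :
    mon (genIdeal K m (completeBipartiteGraph A B))
      (Finsupp.single (i, k) 1 + (Finsupp.single (j, l) 1 + w)) =
    mon (genIdeal K m (completeBipartiteGraph A B))
      (Finsupp.single (i, l) 1 + (Finsupp.single (j, k) 1 + w)) := by
  set G := completeBipartiteGraph A B with hG
  have key : ∀ (h : Fin m) (p : A ⊕ B), w (h, p) ≠ 0 → G.Adj k p → G.Adj p l →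
      mon (genIdeal K m G) (Finsupp.single (i, k) 1 + (Finsupp.single (j, l) 1 + w)) =
      mon (genIdeal K m G) (Finsupp.single (i, l) 1 + (Finsupp.single (j, k) 1 + w)) := by
    intro h p hp hkp hpl
    obtain ⟨w, rfl⟩ := exists_eq_single_add w hp
    simp only [mon_add]
    have e₁ := mon_adj (K := K) G hkp i h
    have e₂ := mon_adj (K := K) G hpl i j
    have e₃ := mon_adj (K := K) G hkp j h
    set x := fun a b => mon (genIdeal K m G) (Finsupp.single (a, b) 1)
    -- The detour through column `p`: `x_ik x_hp x_jl = x_ip x_hk x_jl = x_hk x_il x_jp = x_il x_jk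
    -- x_hp`.
    linear_combination (x j l * mon (genIdeal K m G) w) * e₁ +
      (x h k * mon (genIdeal K m G) w) * e₂ - (x i l * mon (genIdeal K m G) w) * e₃
  have key' : G.Adj k l →
      mon (genIdeal K m G) (Finsupp.single (i, k) 1 + (Finsupp.single (j, l) 1 + w)) =
      mon (genIdeal K m G) (Finsupp.single (i, l) 1 + (Finsupp.single (j, k) 1 + w)) := by
    intro hkl
    simp only [mon_add, ← mul_assoc]
    rw [mon_adj (K := K) G hkl i j]
  rcases k with k | k <;> rcases l with l | l
  · obtain ⟨h, b, hb⟩ := hB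
    exact key h (Sum.inr b) (by simpa using hb) (by simp [hG]) (by simp [hG])
  · exact key' (by simp [hG])
  · exact key' (by simp [hG])
  · obtain ⟨h, a, ha⟩ := hA
    exact key h (Sum.inl a) (by simpa using ha) (by simp [hG]) (by simp [hG])

/-- The left part of the vertex set. -/
def leftPart (A B : Type*) [Fintype A] : Finset (A ⊕ B) := Finset.univ.map Function.Embedding.inl

/-- The right part of the vertex set. -/
def rightPart (A B : Type*) [Fintype B] : Finset (A ⊕ B) := Finset.univ.map Function.Embedding.inr

theorem exists_inr_of_not_subset_leftPart [Fintype A] {u : Fin m × (A ⊕ B) →₀ ℕ}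
    (h : ¬ (u.mapDomain Prod.snd).support ⊆ leftPart A B) : ∃ i b, u (i, Sum.inr b) ≠ 0 := by
  rw [mapDomain_snd_support_subset] at h
  obtain ⟨⟨i, k⟩, hu, hk⟩ := Finset.not_subset.1 h
  rcases k with a | b
  · simp [leftPart] at hk
  · exact ⟨i, b, Finsupp.mem_support_iff.1 hu⟩

theorem exists_inl_of_not_subset_rightPart [Fintype B] {u : Fin m × (A ⊕ B) →₀ ℕ}
    (h : ¬ (u.mapDomain Prod.snd).support ⊆ rightPart A B) : ∃ i a, u (i, Sum.inl a) ≠ 0 := by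
  rw [mapDomain_snd_support_subset] at h
  obtain ⟨⟨i, k⟩, hu, hk⟩ := Finset.not_subset.1 h
  rcases k with a | b
  · exact ⟨i, a, Finsupp.mem_support_iff.1 hu⟩
  · simp [rightPart] at hk

variable [Fintype A] [Fintype B] [DecidableEq A] [DecidableEq B]

/-- The class of a monomial modulo the ideal of a complete bipartite graph: the monomial itself if
its columns lie in one part, its row and column degrees otherwise. -/
noncomputable def monClass (m : ℕ) {A B : Type*} [Fintype A] [Fintype B] [DecidableEq A]
    [DecidableEq B] (u : Fin m × (A ⊕ B) →₀ ℕ) :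
    (Fin m × (A ⊕ B) →₀ ℕ) ⊕ (Fin m →₀ ℕ) × (A ⊕ B →₀ ℕ) :=
  if (u.mapDomain Prod.snd).support ⊆ leftPart A B ∨ (u.mapDomain Prod.snd).support ⊆ rightPart A B
  then Sum.inl u else Sum.inr (u.mapDomain Prod.fst, u.mapDomain Prod.snd)

/-- An edge meets both parts, so both monomials are classified by their margins, which the move
preserves. -/
theorem monClass_eq_of_adj {i j : Fin m} {k l : A ⊕ B} (h : (completeBipartiteGraph A B).Adj k l)
    (w : Fin m × (A ⊕ B) →₀ ℕ) :
    monClass m (w + (Finsupp.single (i, k) 1 + Finsupp.single (j, l) 1)) =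
    monClass m (w + (Finsupp.single (i, l) 1 + Finsupp.single (j, k) 1)) := by
  have hc : (w + (Finsupp.single (i, k) 1 + Finsupp.single (j, l) 1)).mapDomain Prod.snd =
      (w + (Finsupp.single (i, l) 1 + Finsupp.single (j, k) 1)).mapDomain Prod.snd := by
    simp only [Finsupp.mapDomain_add, Finsupp.mapDomain_single]; abel
  have hr : (w + (Finsupp.single (i, k) 1 + Finsupp.single (j, l) 1)).mapDomain Prod.fst =
      (w + (Finsupp.single (i, l) 1 + Finsupp.single (j, k) 1)).mapDomain Prod.fst := by
    simp only [Finsupp.mapDomain_add, Finsupp.mapDomain_single]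
  have hn : ¬ (((w + (Finsupp.single (i, k) 1 + Finsupp.single (j, l) 1)).mapDomain
        Prod.snd).support ⊆ leftPart A B ∨
      ((w + (Finsupp.single (i, k) 1 + Finsupp.single (j, l) 1)).mapDomain
        Prod.snd).support ⊆ rightPart A B) := by
    have hk : k ∈ ((w + (Finsupp.single (i, k) 1 + Finsupp.single (j, l) 1)).mapDomain
        Prod.snd).support := by simp [Finsupp.mapDomain_add]
    have hl : l ∈ ((w + (Finsupp.single (i, k) 1 + Finsupp.single (j, l) 1)).mapDomain
        Prod.snd).support := by simp [Finsupp.mapDomain_add]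
    rintro (hs | hs) <;> have h₁ := hs hk <;> have h₂ := hs hl <;>
      rcases k with k | k <;> rcases l with l | l <;> simp [leftPart, rightPart] at h h₁ h₂
  rw [monClass, monClass, if_neg hn, if_neg (hc ▸ hn), hr, hc]

theorem mon_eq_of_monClass_eq {u v : Fin m × (A ⊕ B) →₀ ℕ} (h : monClass m u = monClass m v) :
    mon (genIdeal K m (completeBipartiteGraph A B)) u =
      mon (genIdeal K m (completeBipartiteGraph A B)) v := by
  unfold monClass at h
  split_ifs at h with hu hv
  · rw [Sum.inl.inj h]
  · obtain ⟨hr, hc⟩ := Prod.ext_iff.1 (Sum.inr.inj h)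
    push Not at hu
    refine margin_induction
      (E := fun u v => mon (genIdeal K m (completeBipartiteGraph A B)) u =
        mon (genIdeal K m (completeBipartiteGraph A B)) v)
      (fun _ => rfl) (fun _ _ _ => Eq.trans) (fun i j k l w _ hc' => ?_) hr hc rfl rfl
    change _ = v.mapDomain Prod.snd at hc'
    simp only at hc
    -- Meeting both parts depends only on the column margins, so it holds at every table along the
    -- path.
    rw [hc, ← hc'] at hu
    exact mon_swap i j k l w (exists_inl_of_not_subset_rightPart hu.2)
      (exists_inr_of_not_subset_leftPart hu.1)

theorem mem_finsuppAntidiag_iff_degree {α : Type*} [DecidableEq α] {s : Finset α} {d : ℕ}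
    {f : α →₀ ℕ} : f ∈ Finset.finsuppAntidiag s d ↔ f.degree = d ∧ f.support ⊆ s :=
  Finset.mem_finsuppAntidiag'

open Finset in
theorem image_monClass (m d : ℕ) :
    monClass (A := A) (B := B) m '' {u | u.degree = d} =
      (((finsuppAntidiag ((univ : Finset (Fin m)) ×ˢ leftPart A B) d ∪
        finsuppAntidiag ((univ : Finset (Fin m)) ×ˢ rightPart A B) d).disjSum
        (finsuppAntidiag (univ : Finset (Fin m)) d ×ˢ (finsuppAntidiag univ d \
          (finsuppAntidiag (leftPart A B) d ∪ finsuppAntidiag (rightPart A B) d))) : Finset _) :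
        Set _) := by
  ext x
  simp only [Set.mem_image, Set.mem_ofPred_eq, mem_coe]
  constructor
  · rintro ⟨u, hu, rfl⟩
    unfold monClass
    split_ifs with h
    · simpa [mem_finsuppAntidiag_iff_degree, hu, ← mapDomain_snd_support_subset,
        -mem_finsuppAntidiag] using h
    · simpa [mem_finsuppAntidiag_iff_degree, hu, Finsupp.degree_mapDomain,
        -mem_finsuppAntidiag] using h
  · rcases x with u | ⟨r, c⟩
    · simp only [inl_mem_disjSum, mem_union, mem_finsuppAntidiag_iff_degree,
        ← mapDomain_snd_support_subset, ← and_or_left]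
      rintro ⟨hu, h⟩
      exact ⟨u, hu, if_pos h⟩
    · simp only [inr_mem_disjSum, mem_product, mem_sdiff, mem_union,
        mem_finsuppAntidiag_iff_degree, ← and_or_left, subset_univ, and_true]
      rintro ⟨hr, hc, h⟩
      obtain ⟨u, rfl, rfl⟩ := exists_margins r c (hr.trans hc.symm)
      rw [Finsupp.degree_mapDomain] at hr
      exact ⟨u, hr, if_neg fun h' => h ⟨hc, h'⟩⟩

open Finset in
-- In degree `0` both sets contain the zero function, hence `d ≠ 0`.
theorem card_finsuppAntidiag_union {α : Type*} [DecidableEq α] {s t : Finset α}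
    (h : Disjoint s t) {d : ℕ} (hd : d ≠ 0) :
    #(finsuppAntidiag s d ∪ finsuppAntidiag t d) = (#s).multichoose d + (#t).multichoose d := by
  rw [card_union_of_disjoint, card_finsuppAntidiag_nat_eq_multichoose,
    card_finsuppAntidiag_nat_eq_multichoose]
  refine disjoint_left.2 fun f hs ht => hd ?_
  rw [mem_finsuppAntidiag_iff_degree] at hs ht
  have h0 : f.support = ∅ := disjoint_self_iff_empty _ |>.1 (h.mono hs.2 ht.2)
  rw [← hs.1, Finsupp.support_eq_empty.1 h0, map_zero]

end CompleteBipartite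

open Finset in
-- The one-part column degrees are moved to the left to avoid truncated subtraction.
theorem hilbertFunction_add {A B : Type*} [Fintype A] [Fintype B] (K : Type*) [Field K] (m : ℕ)
    {d : ℕ} (hd : d ≠ 0) :
    hilbertFunction (genIdeal K m (completeBipartiteGraph A B)) d +
      m.multichoose d * ((Fintype.card A).multichoose d + (Fintype.card B).multichoose d) =
    (m * Fintype.card A).multichoose d + (m * Fintype.card B).multichoose d +
      m.multichoose d * (Fintype.card A + Fintype.card B).multichoose d := by
  classical
  have hdisj : Disjoint (leftPart A B) (rightPart A B) := by
    simp [disjoint_left, leftPart, rightPart]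
  have hA : #(leftPart A B) = Fintype.card A := by simp [leftPart]
  have hB : #(rightPart A B) = Fintype.card B := by simp [rightPart]
  have hcols := card_finsuppAntidiag_union hdisj hd
  rw [hA, hB] at hcols
  have hrows : #(finsuppAntidiag (univ : Finset (Fin m)) d) = m.multichoose d := by
    rw [card_finsuppAntidiag_nat_eq_multichoose, card_univ, Fintype.card_fin]
  rw [hilbertFunction_eq_ncard (monClass m) _ _ (fun u v h => mon_eq_of_monClass_eq h),
    image_monClass, Set.ncard_coe_finset, card_disjSum, card_product,
    card_finsuppAntidiag_union (disjoint_product.2 (Or.inr hdisj)) hd, hrows, add_assoc, ← mul_add,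
    ← hcols, card_sdiff_add_card_eq_card, card_finsuppAntidiag_nat_eq_multichoose,
    card_product, card_product, hA, hB]
  · simp
  · exact union_subset (finsuppAntidiag_mono (subset_univ _) d)
      (finsuppAntidiag_mono (subset_univ _) d)
  · intro f hf
    refine classMap_eq_zero _ ?_ hf
    rintro _ ⟨i, j, k, l, -, h, rfl⟩
    refine ⟨Finsupp.single (i, k) 1 + Finsupp.single (j, l) 1,
      Finsupp.single (i, l) 1 + Finsupp.single (j, k) 1, ?_, monClass_eq_of_adj h⟩
    simp [X, monomial_mul]

end GenBinomEdge
namespace GenBinomEdge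

/-! ### Hilbert polynomial and leading coefficients. -/

section Multiplicity

theorem mult_eq {K : Type*} [Field K] {σ : Type*} {I : Ideal (MvPolynomial σ K)}
    {P : Polynomial ℚ} (hP : IsHilbertPolynomial I P) {D : ℕ} (hD : P.natDegree ≤ D)
    (h0 : P.coeff D ≠ 0) : mult I = D.factorial * P.coeff D := by
  have hex : ∃ P : Polynomial ℚ, IsHilbertPolynomial I P := ⟨P, hP⟩
  have hc : hex.choose = P := hex.choose_spec.unique hP
  have hPD : P.natDegree = D := hD.antisymm (Polynomial.le_natDegree_of_ne_zero h0)
  have hP0 : P ≠ 0 := by rintro rfl; simp at h0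
  rw [mult, dif_pos hex, hc, if_neg hP0, Polynomial.leadingCoeff, hPD]

open Polynomial in
theorem eval_preHilbertPoly {k : ℕ} (hk : 1 ≤ k) (d : ℕ) :
    (preHilbertPoly ℚ (k - 1) 0).eval (d : ℚ) = (k.multichoose d : ℚ) := by
  rw [preHilbertPoly_eq_choose_sub_add ℚ _ (Nat.zero_le d), Nat.multichoose_eq, Nat.sub_zero,
    show k + d - 1 = d + (k - 1) by omega, Nat.choose_symm_add]

/-- The Hilbert polynomial of `S ⧸ J`, for the complete bipartite graph with parts of sizes `a`
and `b`. -/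
noncomputable def bipartitePoly (m a b : ℕ) : Polynomial ℚ :=
  let H := fun k : ℕ => Polynomial.preHilbertPoly ℚ (k - 1) 0
  H (m * a) + H (m * b) + H m * H (a + b) - H m * (H a + H b)

theorem isHilbertPolynomial_bipartitePoly (K : Type*) [Field K] {m a b : ℕ} (hm : 1 ≤ m)
    (ha : 1 ≤ a) (hb : 1 ≤ b) :
    IsHilbertPolynomial (genIdeal K m (completeBipartiteGraph (Fin a) (Fin b)))
      (bipartitePoly m a b) := by
  refine Filter.eventually_atTop.2 ⟨1, fun d hd => ?_⟩
  have h := hilbertFunction_add (A := Fin a) (B := Fin b) K m (d := d) (by omega)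
  rw [Fintype.card_fin, Fintype.card_fin] at h
  have h' := congrArg (Nat.cast (R := ℚ)) h
  push_cast at h'
  simp only [bipartitePoly, Polynomial.eval_sub, Polynomial.eval_add, Polynomial.eval_mul,
    eval_preHilbertPoly hm, eval_preHilbertPoly ha, eval_preHilbertPoly hb,
    eval_preHilbertPoly (Nat.mul_pos hm ha), eval_preHilbertPoly (Nat.mul_pos hm hb),
    eval_preHilbertPoly (show 1 ≤ a + b by omega)]
  linarith

open Polynomial in
theorem factorial_mul_coeff_preHilbertPoly {D k : ℕ} (h : k ≤ D) :
    (D.factorial : ℚ) * (preHilbertPoly ℚ k 0).coeff D = if k = D then 1 else 0 := by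
  split_ifs with hk
  · subst hk
    rw [coeff_preHilbertPoly_self, mul_inv_cancel₀ (by positivity)]
  · rw [coeff_eq_zero_of_natDegree_lt (by rw [natDegree_preHilbertPoly]; omega), mul_zero]

open Polynomial in
theorem natDegree_preHilbertPoly_mul_le (k l : ℕ) :
    (preHilbertPoly ℚ k 0 * preHilbertPoly ℚ l 0).natDegree ≤ k + l :=
  natDegree_mul_le.trans (by rw [natDegree_preHilbertPoly, natDegree_preHilbertPoly])

open Polynomial in
theorem factorial_mul_coeff_preHilbertPoly_mul {D k l : ℕ} (h : k + l ≤ D) :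
    (D.factorial : ℚ) * (preHilbertPoly ℚ k 0 * preHilbertPoly ℚ l 0).coeff D =
      if k + l = D then ((k + l).choose k : ℚ) else 0 := by
  split_ifs with hk
  · subst hk
    rw [coeff_mul_add_eq_of_natDegree_le (natDegree_preHilbertPoly ..).le
      (natDegree_preHilbertPoly ..).le, coeff_preHilbertPoly_self, coeff_preHilbertPoly_self,
      Nat.cast_add_choose]
    field_simp
  · rw [coeff_eq_zero_of_natDegree_lt
      ((natDegree_preHilbertPoly_mul_le k l).trans_lt (by omega)), mul_zero]

/-- The multiplicity of the generalized binomial edge ideal of a complete bipartite graph is the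
sum of the contributions of the components of maximal dimension `D + 1`. -/
theorem mult_completeBipartite (K : Type*) [Field K] {m a b D : ℕ} (hm : 1 ≤ m)
    (ha : 1 ≤ a) (hb : 1 ≤ b) (h₁ : m * a ≤ D + 1) (h₂ : m * b ≤ D + 1) (h₃ : m + a + b ≤ D + 2)
    (h : m * a = D + 1 ∨ m * b = D + 1 ∨ m + a + b = D + 2) :
    mult (genIdeal K m (completeBipartiteGraph (Fin a) (Fin b))) =
      (if m * a = D + 1 then 1 else 0) + (if m * b = D + 1 then 1 else 0) +
        if m + a + b = D + 2 then ((m + a + b - 2).choose (m - 1) : ℚ) else 0 := by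
  have hma : 1 ≤ m * a := Nat.mul_pos hm ha
  have hmb : 1 ≤ m * b := Nat.mul_pos hm hb
  have hcoeff : (D.factorial : ℚ) * (bipartitePoly m a b).coeff D =
      (if m * a = D + 1 then 1 else 0) + (if m * b = D + 1 then 1 else 0) +
        if m + a + b = D + 2 then ((m + a + b - 2).choose (m - 1) : ℚ) else 0 := by
    simp only [bipartitePoly, Polynomial.coeff_sub, Polynomial.coeff_add, mul_add, mul_sub]
    rw [factorial_mul_coeff_preHilbertPoly (by omega), factorial_mul_coeff_preHilbertPoly (by omega),
      factorial_mul_coeff_preHilbertPoly_mul (by omega),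
      factorial_mul_coeff_preHilbertPoly_mul (by omega),
      factorial_mul_coeff_preHilbertPoly_mul (by omega),
      -- As `a, b ≥ 1`, the subtracted products have degree below `m + a + b - 2 ≤ D`.
      if_neg (show m - 1 + (a - 1) ≠ D by omega), if_neg (show m - 1 + (b - 1) ≠ D by omega),
      show m - 1 + (a + b - 1) = m + a + b - 2 by omega]
    simp only [show m * a - 1 = D ↔ m * a = D + 1 by omega,
      show m * b - 1 = D ↔ m * b = D + 1 by omega,
      show m + a + b - 2 = D ↔ m + a + b = D + 2 by omega]
    ring
  rw [← hcoeff]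
  refine mult_eq (isHilbertPolynomial_bipartitePoly K hm ha hb) ?_ fun h0 => ?_
  · simp only [bipartitePoly, mul_add]
    have hH : ∀ k l, k + l ≤ D → (Polynomial.preHilbertPoly ℚ k 0 *
        Polynomial.preHilbertPoly ℚ l 0).natDegree ≤ D := fun k l hkl =>
      (natDegree_preHilbertPoly_mul_le k l).trans hkl
    have hS : ∀ k, k ≤ D → (Polynomial.preHilbertPoly ℚ k 0).natDegree ≤ D := fun k hk =>
      (Polynomial.natDegree_preHilbertPoly ℚ k 0).trans_le hk
    have h₄ := Polynomial.natDegree_add_le_of_degree_le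
      (Polynomial.natDegree_add_le_of_degree_le (hS (m * a - 1) (by omega))
        (hS (m * b - 1) (by omega))) (hH (m - 1) (a + b - 1) (by omega))
    have h₅ := Polynomial.natDegree_add_le_of_degree_le (hH (m - 1) (a - 1) (by omega))
      (hH (m - 1) (b - 1) (by omega))
    exact (Polynomial.natDegree_sub_le_of_le h₄ h₅).trans_eq (max_self D)
  · rw [h0, mul_zero] at hcoeff
    have hch : (0 : ℚ) < ((m + a + b - 2).choose (m - 1) : ℚ) :=
      Nat.cast_pos.2 (Nat.choose_pos (by omega))
    split_ifs at hcoeff <;> first | omega | linarith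

/-- Vandermonde's identity after the reflection `k ↦ p - k`. -/
theorem sum_choose_mul_choose (p q : ℕ) :
    ∑ k ∈ Finset.range (p + 1), p.choose k * q.choose k = (p + q).choose p := by
  rw [Nat.add_choose_eq, Finset.Nat.sum_antidiagonal_eq_sum_range_succ_mk,
    ← Finset.sum_range_reflect]
  refine Finset.sum_congr rfl fun k hk => ?_
  have hk' := Finset.mem_range_succ_iff.1 hk
  rw [show p + 1 - 1 - k = p - k by omega, Nat.choose_symm hk']

end Multiplicity

end GenBinomEdge

/-! ### The five numerical cases. -/

theorem mainTheorem6 (K : Type*) [Field K] (m n₁ n₂ : ℕ)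
    (hm : 2 ≤ m) (hn₁ : 1 ≤ n₁) (hle : n₁ ≤ n₂) (hn₂ : 2 ≤ n₂) :
    (max (m + n₁ + n₂ - 1) (m * n₁) < m * n₂ →
      GenBinomEdge.mult
      (GenBinomEdge.genIdeal K m (completeBipartiteGraph (Fin n₁) (Fin n₂))) = 1) ∧
    (m + n₁ + n₂ - 1 < m * n₁ ∧ m * n₁ = m * n₂ →
      GenBinomEdge.mult
      (GenBinomEdge.genIdeal K m (completeBipartiteGraph (Fin n₁) (Fin n₂))) = 2) ∧
    (m * n₂ < m + n₁ + n₂ - 1 →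
      GenBinomEdge.mult
      (GenBinomEdge.genIdeal K m (completeBipartiteGraph (Fin n₁) (Fin n₂))) = 2 * n₂) ∧
    (m + n₁ + n₂ - 1 = m * n₁ ∧ m * n₁ = m * n₂ →
      GenBinomEdge.mult
      (GenBinomEdge.genIdeal K m (completeBipartiteGraph (Fin n₁) (Fin n₂))) = 12) ∧
    (m * n₁ < m + n₁ + n₂ - 1 ∧ m + n₁ + n₂ - 1 = m * n₂ →
      GenBinomEdge.mult
      (GenBinomEdge.genIdeal K m (completeBipartiteGraph (Fin n₁) (Fin n₂))) =
        (∑ k ∈ Finset.range m, ((m - 1).choose k : ℚ) * ((n₁ + n₂ - 1).choose k : ℚ)) + 1) ∧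
    (max (m + n₁ + n₂ - 1) (m * n₁) < m * n₂ ∨
      (m + n₁ + n₂ - 1 < m * n₁ ∧ m * n₁ = m * n₂) ∨
      m * n₂ < m + n₁ + n₂ - 1 ∨
      (m + n₁ + n₂ - 1 = m * n₁ ∧ m * n₁ = m * n₂) ∨
      (m * n₁ < m + n₁ + n₂ - 1 ∧ m + n₁ + n₂ - 1 = m * n₂)) := by
  have hmul : m * n₁ ≤ m * n₂ := Nat.mul_le_mul_left m hle
  have hm1 : 1 ≤ m := by omega
  have hb : 1 ≤ n₂ := by omega
  have hpos : 1 ≤ m * n₂ := Nat.mul_pos hm1 hb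
  refine ⟨fun h => ?_, fun h => ?_, fun h => ?_, fun h => ?_, fun h => ?_, by omega⟩
  · rw [GenBinomEdge.mult_completeBipartite K (D := m * n₂ - 1) hm1 hn₁ hb (by omega) (by omega)
      (by omega) (by omega), if_neg (by omega), if_pos (by omega), if_neg (by omega)]
    norm_num
  · rw [GenBinomEdge.mult_completeBipartite K (D := m * n₂ - 1) hm1 hn₁ hb (by omega) (by omega)
      (by omega) (by omega), if_pos (by omega), if_pos (by omega), if_neg (by omega)]
    norm_num
  -- For `m ≥ 3` and `n₂ ≥ 2`, `m * n₂ ≥ m + 2 * n₂ - 1`, against `h`. The surviving binomial is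
  -- then `C(2n₁, 1)`.
  · obtain ⟨rfl, rfl⟩ : m = 2 ∧ n₁ = n₂ := by
      have hm2 : m = 2 := by
        by_contra hne
        obtain ⟨p, rfl⟩ := Nat.exists_eq_add_of_le (show 3 ≤ m by omega)
        have hp : p * 2 ≤ p * n₂ := Nat.mul_le_mul_left p hn₂
        rw [add_mul] at h
        omega
      subst hm2
      exact ⟨rfl, by omega⟩
    rw [GenBinomEdge.mult_completeBipartite K (D := 2 * n₁) hm1 hn₁ hb (by omega) (by omega)
      (by omega) (by omega), if_neg (by omega), if_pos (by omega),
      show 2 + n₁ + n₁ - 2 = 2 * n₁ by omega]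
    simp
  · have hnn : n₁ = n₂ := Nat.eq_of_mul_eq_mul_left (by omega) h.2
    subst hnn
    -- The equation reads `(m - 2)(n₁ - 1) = 1`; the value is then `1 + 1 + C(5, 2) = 12`.
    obtain ⟨rfl, rfl⟩ : m = 3 ∧ n₁ = 2 := by
      obtain ⟨p, rfl⟩ := Nat.exists_eq_add_of_le hm
      obtain ⟨q, rfl⟩ := Nat.exists_eq_add_of_le hn₂
      have hpq : p * (q + 1) = 1 := by
        have h1 := h.1
        have e : (2 + p) * (2 + q) = 3 + p + 2 * q + p * (q + 1) + 1 := by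
          ring
        omega
      have hp := Nat.eq_one_of_mul_eq_one_right hpq
      have hq := Nat.eq_one_of_mul_eq_one_left hpq
      omega
    rw [GenBinomEdge.mult_completeBipartite K (D := 5) hm1 hn₁ hb (by omega) (by omega)
      (by omega) (by omega), if_pos (by omega), if_pos (by omega),
      show Nat.choose (3 + 2 + 2 - 2) (3 - 1) = 10 by decide]
    norm_num
  · rw [GenBinomEdge.mult_completeBipartite K (D := m * n₂ - 1) hm1 hn₁ hb (by omega) (by omega)
      (by omega) (by omega), if_neg (by omega), if_pos (by omega), if_pos (by omega)]
    have hs := GenBinomEdge.sum_choose_mul_choose (m - 1) (n₁ + n₂ - 1)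
    rw [Nat.sub_add_cancel hm1, show m - 1 + (n₁ + n₂ - 1) = m + n₁ + n₂ - 2 by omega] at hs
    rw [← hs]
    push_cast
    ring
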